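/- Identify $P(\omega)$ with the Cantor cube $\{0,1\}^\omega$ via characteristic functions, let $\mathrm{Fin}$ and $[\omega]^\omega$ be the families of finite and of infinite subsets of $\omega$, and identify each element of $[\omega]^\omega$ with its increasing enumeration. Let $\mathfrak b$ be the minimal cardinality of a set $A\subseteq\omega^\omega$ that is unbounded, i.e. for which there is no $g\in\omega^\omega$ such that for every $f\in A$ we have $f(n)\le g(n)$ for all but finitely many $n$. A semifilter is a nonempty $S\subseteq[\omega]^\omega$ such that $b\in S$ whenever $a\in S$, $b\in[\omega]^\omega$ and $a\setminus b$ is finite; it is meager if it is a meager subset of the space $[\omega]^\omega$. For $a,b\in[\omega]^\omega$ write $a\le_S b$ if $\{n: a(n)\le b(n)\}\in S$. A set $X\subseteq[\omega]^\omega$ is meager-unbounded if $|X|\ge\mathfrak b$ and for each $b\in[\omega]^\omega$ there are a meager semifilter $S$ and a set $A\subseteq X$ with $|A|<\mathfrak b$ such that $b\le_S x$ for all $x\in X\setminus A$. For $D\subseteq Y\subseteq P(\omega)$, the set $Y$ is $\mathfrak b$-concentrated on $D$ if $|Y|\ge\mathfrak b$ and $|Y\setminus U|<\mathfrak b$ for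 every open set $U\supseteq D$. A space $Y$ is Hurewicz if for every sequence $\mathcal U_0,\mathcal U_1,\dots$ of open covers of $Y$ there are finite sets $\mathcal F_n\subseteq\mathcal U_n$ such that each $y\in Y$ belongs to $\bigcup\mathcal F_n$ for all but finitely many $n$. Theorem (ZFC). For every $X\subseteq[\omega]^\omega$ the following are equivalent: (1) $X$ is meager-unbounded; (2) $|X|\ge\mathfrak b$, and for each $G_\delta$ set $G\subseteq P(\omega)$ containing $\mathrm{Fin}$ there is a $\sigma$-compact set $F\subseteq G$ with $|X\setminus F|<\mathfrak b$; (3) the set $X\cup\mathrm{Fin}$ is $\mathfrak b$-concentrated on $\mathrm{Fin}$, and for each set $A\subseteq X$ with $|A|<\mathfrak b$ the set $(X\setminus A)\cup\mathrm{Fin}$ is Hurewicz. -/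

import Mathlib

open Cardinal

/-- The power set `P(ω)`, each set being identified with its characteristic function; the
topology is that of the Cantor cube (product of discrete two-point spaces). -/
abbrev POmega : Type := ℕ → Bool

/-- The subset of `ω` with characteristic function `x`. -/
def POmega.toSet (x : POmega) : Set ℕ := {n | x n = true}

/-- `Fin`, the family of all finite subsets of `ω`. -/
def finSets : Set POmega := {x | x.toSet.Finite}

/-- `[ω]^ω`, the family of all infinite subsets of `ω`. -/
def infSets : Set POmega := {x | x.toSet.Infinite}

/-- The increasing enumeration of (the set with characteristic function) `x`.
It is only used for `x ∈ infSets`. -/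
noncomputable def POmega.enum (x : POmega) : ℕ → ℕ := Nat.nth (fun n => n ∈ x.toSet)

/-- `A ⊆ ω^ω` is bounded: some `g` eventually dominates every member of `A`. -/
def IsStarBounded (A : Set (ℕ → ℕ)) : Prop :=
  ∃ g : ℕ → ℕ, ∀ f ∈ A, {n | ¬ f n ≤ g n}.Finite

/-- The bounding number `𝔟`, the minimal cardinality of an unbounded subset of `ω^ω`. -/
noncomputable def boundingNumber : Cardinal.{0} :=
  sInf {c | ∃ A : Set (ℕ → ℕ), ¬ IsStarBounded A ∧ #A = c}

/-- A semifilter: a nonempty family of infinite subsets of `ω` which is closed under infinite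
almost-supersets. -/
structure IsSemifilter (S : Set POmega) : Prop where
  nonempty : S.Nonempty
  subset_infSets : S ⊆ infSets
  mem_of_almost_subset : ∀ a ∈ S, ∀ b ∈ infSets, (a.toSet \ b.toSet).Finite → b ∈ S

/-- `S` is meager as a subset of the space `[ω]^ω`. -/
def IsMeagerInInfSets (S : Set POmega) : Prop :=
  IsMeagre ((fun x : infSets => (x : POmega)) ⁻¹' S)

/-- `a ≤_S b`: the set `{n | a(n) ≤ b(n)}` belongs to `S`, where `a` and `b` are identified with
their increasing enumerations. -/
def LeMod (S : Set POmega) (a b : POmega) : Prop :=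
  (fun n => decide (a.enum n ≤ b.enum n)) ∈ S

/-- Meager-unbounded subsets of `[ω]^ω`. -/
def IsMeagerUnbounded (X : Set POmega) : Prop :=
  X ⊆ infSets ∧ boundingNumber ≤ #X ∧
    ∀ b ∈ infSets, ∃ S : Set POmega, IsSemifilter S ∧ IsMeagerInInfSets S ∧
      ∃ A ⊆ X, #A < boundingNumber ∧ ∀ x ∈ X \ A, LeMod S b x

/-- `X` is `κ`-concentrated on `D`. -/
def IsConcentratedOn {α : Type} [TopologicalSpace α] (κ : Cardinal.{0}) (X D : Set α) : Prop :=
  D ⊆ X ∧ κ ≤ #X ∧ ∀ U : Set α, IsOpen U → D ⊆ U → #(X \ U : Set α) < κ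

/-- The Hurewicz covering property of a topological space `Y`: for every sequence of open covers
`𝒰 n` there are finite `ℱ n ⊆ 𝒰 n` such that each point lies in `⋃ ℱ n` for all but finitely
many `n`. -/
def IsHurewiczSpace (Y : Type) [TopologicalSpace Y] : Prop :=
  ∀ 𝒰 : ℕ → Set (Set Y), (∀ n, (∀ u ∈ 𝒰 n, IsOpen u) ∧ ⋃₀ 𝒰 n = Set.univ) →
    ∃ ℱ : ℕ → Set (Set Y), (∀ n, ℱ n ⊆ 𝒰 n ∧ (ℱ n).Finite) ∧
      ∀ y : Y, {n | y ∉ ⋃₀ ℱ n}.Finite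

/-!
For an infinite set `x`, the inequality `m ≤ x(n)` between a number and a value of the increasing
enumeration says that `x` has at most `n` elements below `m`. This is a clopen condition, and it
makes sense, with the same meaning, for finite `x`; all three conditions are compared through it.

From the first condition to the second: a `G_δ` set `G ⊇ Fin` contains every `x` that misses
infinitely many intervals of a suitable sparse partition of `ω` (`exists_gap_subset`). Hence there
is `b` such that `x ∈ G` as soon as `b(n) ≤ x(n)` for infinitely many `n`, by the pigeonhole
principle (`le_count_of_meets`). A meager semifilter comes with an interval partition almost all of
whose intervals meet each member (`IsSemifilter.exists_interval_partition`). The points `x` such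
that almost all of the intervals contain an `n` with `b(n) ≤ x(n)` form a `σ`-compact subset of `G`.

From the second to the third: concentration is immediate. For a sequence of countable open covers,
each compact piece of a `σ`-compact set gives a function bounding the indices needed to cover it,
and so does each of the fewer than `𝔟` remaining points. By the definition of `𝔟` these functions
have a common eventual bound, which gives the finite subfamilies
(`isHurewiczSpace_of_isSigmaCompact`).

From the third to the first: the points `x` with `b(n) ≤ x(n)` for infinitely many `n` are all but
fewer than `𝔟` members of `X`, because `𝔟` has uncountable cofinality
(`mk_iUnion_lt_boundingNumber`). The Hurewicz property, applied to the covers by the sets of `x`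
with `b(n) ≤ x(n)` for some `n ∈ [k, m)`, gives one function `g` such that each of these `x` has such
an `n` in `[k, g k)` for almost all `k`. The infinite sets meeting almost all of the intervals
`[k, g k)` form a meager semifilter (`exists_meager_semifilter`).
-/

/-! ### The bounding number -/

theorem not_isStarBounded_univ : ¬ IsStarBounded Set.univ := by
  rintro ⟨g, hg⟩
  have h := hg (fun n => g n + 1) trivial
  have hu : {n | ¬ (g n + 1 ≤ g n)} = Set.univ := by ext n; simp
  exact Set.infinite_univ (hu ▸ h)

theorem exists_not_isStarBounded_mk_eq :
    ∃ A : Set (ℕ → ℕ), ¬ IsStarBounded A ∧ #A = boundingNumber :=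
  csInf_mem (s := {c | ∃ A : Set (ℕ → ℕ), ¬ IsStarBounded A ∧ #A = c})
    ⟨_, _, not_isStarBounded_univ, rfl⟩

theorem isStarBounded_of_mk_lt {A : Set (ℕ → ℕ)} (h : #A < boundingNumber) :
    IsStarBounded A := by
  by_contra hA
  exact notMem_of_lt_csInf' h ⟨A, hA, rfl⟩

theorem IsStarBounded.mono {A B : Set (ℕ → ℕ)} (hB : IsStarBounded B) (h : A ⊆ B) :
    IsStarBounded A := by
  obtain ⟨g, hg⟩ := hB
  exact ⟨g, fun f hf => hg f (h hf)⟩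

theorem isStarBounded_range (f : ℕ → ℕ → ℕ) : IsStarBounded (Set.range f) := by
  -- The diagonal maximum of `f 0, …, f n` at `n` dominates `f k` from `k` on.
  refine ⟨fun n => (Finset.range (n + 1)).sup fun k => f k n, ?_⟩
  rintro _ ⟨k, rfl⟩
  refine (Set.finite_lt_nat k).subset fun n hn => ?_
  by_contra hkn
  exact hn (Finset.le_sup (f := fun k => f k n) (Finset.mem_range.2 (by
    have : ¬ n < k := hkn
    omega)))

theorem isStarBounded_iUnion {A : ℕ → Set (ℕ → ℕ)} (h : ∀ k, IsStarBounded (A k)) :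
    IsStarBounded (⋃ k, A k) := by
  choose g hg using h
  obtain ⟨G, hG⟩ := isStarBounded_range g
  refine ⟨G, fun f hf => ?_⟩
  obtain ⟨k, hk⟩ := Set.mem_iUnion.1 hf
  refine ((hg k f hk).union (hG _ ⟨k, rfl⟩)).subset fun n hn => ?_
  by_contra hcon
  simp only [Set.mem_union, Set.mem_ofPred_eq, not_or, not_not] at hcon hn
  omega

theorem aleph0_lt_boundingNumber : ℵ₀ < boundingNumber := by
  by_contra! hle
  obtain ⟨A, hA, hAc⟩ := exists_not_isStarBounded_mk_eq
  have hc : A.Countable := Cardinal.le_aleph0_iff_set_countable.1 (hAc ▸ hle)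
  rcases A.eq_empty_or_nonempty with rfl | hne
  · exact hA ⟨0, by simp⟩
  · obtain ⟨f, rfl⟩ := hc.exists_eq_range hne
    exact hA (isStarBounded_range f)

/-- The bounding number has uncountable cofinality: an unbounded family of size `𝔟` cannot be
split into countably many bounded pieces. -/
theorem mk_iUnion_lt_boundingNumber {α : Type} {A : ℕ → Set α}
    (h : ∀ k, #(A k) < boundingNumber) : #(⋃ k, A k : Set α) < boundingNumber := by
  by_contra! hle
  obtain ⟨B, hB, hBc⟩ := exists_not_isStarBounded_mk_eq
  rw [← hBc, Cardinal.le_def] at hle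
  obtain ⟨e⟩ := hle
  have he : Function.Injective fun f => (e f : α) := Subtype.val_injective.comp e.injective
  refine hB ((isStarBounded_iUnion (A := fun k => Subtype.val '' ((fun f => (e f : α)) ⁻¹' A k))
    fun k => isStarBounded_of_mk_lt (Cardinal.mk_image_le.trans
      (Cardinal.mk_preimage_of_injective _ _ he) |>.trans_lt (h k))).mono fun f hf => ?_)
  obtain ⟨k, hk⟩ := Set.mem_iUnion.1 (e ⟨f, hf⟩).2
  exact Set.mem_iUnion.2 ⟨k, ⟨f, hf⟩, hk, rfl⟩

theorem mk_union_lt_boundingNumber {α : Type} {A B : Set α}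
    (hA : #A < boundingNumber) (hB : #B < boundingNumber) :
    #(A ∪ B : Set α) < boundingNumber :=
  (Cardinal.mk_union_le A B).trans_lt
    (Cardinal.add_lt_of_lt aleph0_lt_boundingNumber.le hA hB)

/-! ### The topology of the Cantor cube -/

theorem POmega.exists_agree_subset_of_isOpen {U : Set POmega} (hU : IsOpen U) {x : POmega}
    (hx : x ∈ U) : ∃ m, ∀ y : POmega, (∀ n < m, y n = x n) → y ∈ U := by
  obtain ⟨_, ⟨z, m, rfl⟩, hxz, hsub⟩ :=
    (PiNat.isTopologicalBasis_cylinders fun _ : ℕ => Bool).exists_subset_of_mem_open hx hU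
  refine ⟨m, fun y hy => hsub ?_⟩
  rw [PiNat.mem_cylinder_iff] at hxz ⊢
  exact fun i hi => (hy i hi).trans (hxz i hi)

theorem POmega.isOpen_agree (x : POmega) (m : ℕ) : IsOpen {y : POmega | ∀ n < m, y n = x n} :=
  PiNat.isOpen_cylinder (fun _ : ℕ => Bool) x m

theorem isClopen_apply_eq_true (n : ℕ) : IsClopen {x : POmega | x n = true} :=
  (isClopen_discrete {true}).preimage (continuous_apply n)

theorem countable_finSets : finSets.Countable := by
  refine (Set.Countable.ofPred_finite (α := ℕ)).preimage (f := POmega.toSet) fun x y h => ?_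
  funext n
  have : x n = true ↔ y n = true := Set.ext_iff.1 h n
  exact Bool.eq_iff_iff.2 this

/-- An open neighbourhood of `Fin` contains, for each `k`, every set that misses a long enough
interval starting at `k`. By compactness, since a set missing all of `[k, ∞)` is finite. -/
theorem exists_gap_subset {U : Set POmega} (hU : IsOpen U) (hfin : finSets ⊆ U) (k : ℕ) :
    ∃ g, k < g ∧ ∀ x : POmega, (∀ n ∈ Set.Ico k g, x n = false) → x ∈ U := by
  let V : ℕ → Set POmega := fun g => {x | ∀ n ∈ Set.Ico k g, x n = false}
  have hanti : Antitone V := fun a b hab x hx n hn => hx n ⟨hn.1, hn.2.trans_le hab⟩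
  have hclosed : ∀ g, IsClosed (V g) := fun g => by
    have : V g = ⋂ n ∈ Set.Ico k g, {x : POmega | x n = true}ᶜ := by ext x; simp [V]
    rw [this]
    exact isClosed_biInter fun n _ => (isClopen_apply_eq_true n).compl.isClosed
  have hV : ⋂ g, V g ⊆ finSets := fun x hx => (Set.finite_lt_nat k).subset fun n hn => by
    by_contra hkn
    have h1 := Set.mem_iInter.1 hx (n + 1) n ⟨not_lt.1 hkn, n.lt_succ_self⟩
    have h2 : x n = true := hn
    simp [h1] at h2
  obtain ⟨g, hg⟩ := exists_subset_nhds_of_compactSpace hanti.directed_ge hclosed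
    fun x hx => hU.mem_nhds (hfin (hV hx))
  refine ⟨max g (k + 1), by simp, fun x hx => hg fun n hn => hx n ⟨hn.1, ?_⟩⟩
  exact hn.2.trans_le (le_max_left _ _)

/-! ### Increasing enumerations -/

theorem le_enum_iff {x : POmega} (hx : x ∈ infSets) {m n : ℕ} :
    m ≤ x.enum n ↔ Nat.count (fun i => x i = true) m ≤ n :=
  (Nat.count_le_iff_le_nth (p := fun i => x i = true) hx).symm

theorem continuous_count (m : ℕ) :
    Continuous fun x : POmega => Nat.count (fun i => x i = true) m := by
  induction m with
  | zero => simpa using continuous_const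
  | succ m ih =>
    simp only [Nat.count_succ]
    exact ih.add ((continuous_of_discreteTopology
      (f := fun b : Bool => if b = true then 1 else 0)).comp (continuous_apply m))

theorem isClopen_count_le (m n : ℕ) :
    IsClopen {x : POmega | Nat.count (fun i => x i = true) m ≤ n} :=
  (isClopen_discrete (Set.Iic n)).preimage (continuous_count m)

theorem enum_strictMono {x : POmega} (hx : x ∈ infSets) : StrictMono x.enum :=
  Nat.nth_strictMono hx

theorem enum_mem {x : POmega} (hx : x ∈ infSets) (n : ℕ) : x (x.enum n) = true :=
  Nat.nth_mem_of_infinite hx n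

theorem exists_le_enum {c : ℕ → ℕ} (hc : StrictMono c) : ∃ b ∈ infSets, ∀ n, c n ≤ b.enum n := by
  classical
  let b : POmega := fun m => decide (m ∈ Set.range c)
  have hb : b ∈ infSets := by
    have : b.toSet = Set.range c := by ext m; simp [b, POmega.toSet]
    change b.toSet.Infinite
    rw [this]
    exact Set.infinite_range_of_injective hc.injective
  refine ⟨b, hb, fun n => ?_⟩
  have hmem : ∀ n, ∃ k, c k = b.enum n := fun n => by simpa [b] using enum_mem hb n
  choose h hh using hmem
  have hmono : StrictMono h := fun i j hij => by
    rw [← hc.lt_iff_lt, hh, hh]; exact enum_strictMono hb hij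
  exact (hc.monotone hmono.le_apply).trans_eq (hh n)

/-- If `x` meets each of the consecutive intervals `[c j, c (j+1))`, `n ≤ j < n + p`, then it has
at least `p` elements below `c (n + p)`. -/
theorem le_count_of_meets {x : POmega} {c : ℕ → ℕ} (n p : ℕ)
    (h : ∀ j ∈ Set.Ico n (n + p), ∃ i ∈ Set.Ico (c j) (c (j + 1)), x i = true) :
    p ≤ Nat.count (fun i => x i = true) (c (n + p)) := by
  induction p with
  | zero => simp
  | succ p ih =>
    have h1 := ih fun j hj => h j ⟨hj.1, hj.2.trans (by omega)⟩
    obtain ⟨i, ⟨hi1, hi2⟩, hxi⟩ := h (n + p) ⟨by omega, by omega⟩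
    have h2 := Nat.count_monotone (fun i => x i = true) hi1
    have h3 := Nat.count_strict_mono (p := fun i => x i = true) hxi hi2
    rw [add_assoc] at h3
    omega

/-! ### Meager semifilters and interval partitions -/

/-- Finitely many nowhere dense sets, each with a prescribed initial segment, are avoided by
prescribing one pattern `t` on a single interval `[i, j)`. -/
theorem exists_pattern_avoiding {N : ℕ → Set infSets} (hN : ∀ l, IsNowhereDense (N l)) (i : ℕ)
    (T : Finset (ℕ × POmega)) : ∃ j, i < j ∧ ∃ t : POmega, ∀ q ∈ T, ∀ x : infSets,
      (∀ n < i, x.1 n = q.2 n) → (∀ n ∈ Set.Ico i j, x.1 n = t n) → x ∉ N q.1 := by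
  classical
  induction T using Finset.induction_on with
  | empty => exact ⟨i + 1, by omega, 0, by simp⟩
  | insert q T _ ih =>
    obtain ⟨j, hij, t, ht⟩ := ih
    let p : POmega := fun n => if n < i then q.2 n else if n < j then t n else true
    have hp : p ∈ infSets := by
      refine (Set.Ici_infinite j).mono fun n hn => ?_
      have h1 : j ≤ n := hn
      have : p n = true := by simp only [p]; rw [if_neg (by omega), if_neg (by omega)]
      exact this
    -- The cylinder of `p` on `[0, j)` is a nonempty open set, so it is not inside `closure (N q.1)`.
    obtain ⟨x, hxp, hxN⟩ : ∃ x : infSets, (∀ n < j, x.1 n = p n) ∧ x ∉ closure (N q.1) := by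
      by_contra! hcon
      have hO : IsOpen {x : infSets | ∀ n < j, x.1 n = p n} :=
        (POmega.isOpen_agree p j).preimage continuous_subtype_val
      have : (⟨p, hp⟩ : infSets) ∈ interior (closure (N q.1)) :=
        interior_maximal (fun x hx => hcon x hx) hO (fun n _ => rfl)
      rw [(hN q.1 : interior (closure (N q.1)) = ∅)] at this
      exact this
    obtain ⟨O, hO, hOx⟩ := isOpen_induced_iff.1 (isClosed_closure (s := N q.1)).isOpen_compl
    have hxO : x.1 ∈ O := by
      have : x ∈ Subtype.val ⁻¹' O := by rw [hOx]; exact hxN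
      exact this
    obtain ⟨m, hm⟩ := POmega.exists_agree_subset_of_isOpen hO hxO
    refine ⟨max j m, lt_max_of_lt_left hij, x.1, fun r hr y hy1 hy2 => ?_⟩
    rcases Finset.mem_insert.1 hr with rfl | hr
    · have hyO : y.1 ∈ O := hm y.1 fun n hn => by
        rcases lt_or_ge n i with hni | hni
        · rw [hy1 n hni, hxp n (hni.trans hij)]; simp [p, hni]
        · exact hy2 n ⟨hni, hn.trans_le (le_max_right _ _)⟩
      have hyc : y ∈ (closure (N r.1))ᶜ := by rw [← hOx]; exact hyO
      exact fun hyN => hyc (subset_closure hyN)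
    · refine ht r hr y hy1 fun n hn => ?_
      rw [hy2 n ⟨hn.1, hn.2.trans_le (le_max_left _ _)⟩, hxp n hn.2]
      simp only [p]; rw [if_neg (by have := hn.1; omega), if_pos hn.2]

/-- As `exists_pattern_avoiding`, but for all of the finitely many initial segments below `i`. -/
theorem exists_pattern_avoiding_all {N : ℕ → Set infSets} (hN : ∀ l, IsNowhereDense (N l))
    (k i : ℕ) : ∃ j, i < j ∧ ∃ t : POmega, ∀ l ≤ k, ∀ x : infSets,
      (∀ n ∈ Set.Ico i j, x.1 n = t n) → x ∉ N l := by
  classical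
  obtain ⟨j, hij, t, ht⟩ := exists_pattern_avoiding hN i (Finset.range (k + 1) ×ˢ
    (Finset.univ : Finset (Fin i → Bool)).image fun s n => if h : n < i then s ⟨n, h⟩ else false)
  refine ⟨j, hij, t, fun l hl x hx => ?_⟩
  refine ht (l, fun n => if h : n < i then x.1 n else false) ?_ x (fun n hn => by simp [hn]) hx
  simp only [Finset.mem_product, Finset.mem_range, Finset.mem_image, Finset.mem_univ, true_and]
  exact ⟨by omega, fun n => x.1 n, rfl⟩

/-- The easy half of Talagrand's characterization of meager semifilters: there is an interval
partition such that each member of the semifilter meets all but finitely many intervals.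
A member missing infinitely many intervals could be enlarged by the avoiding patterns on these
intervals, to a member outside all the nowhere dense sets that cover the semifilter. -/
theorem IsSemifilter.exists_interval_partition {S : Set POmega} (hS : IsSemifilter S)
    (hm : IsMeagerInInfSets S) : ∃ i : ℕ → ℕ, StrictMono i ∧
      ∀ s ∈ S, ∃ m, ∀ k ≥ m, ∃ n ∈ Set.Ico (i k) (i (k + 1)), s n = true := by
  classical
  obtain ⟨C, hC, hCc, hSC⟩ := isMeagre_iff_countable_union_isNowhereDense.1 hm
  obtain ⟨N, hNr⟩ := (hCc.insert ∅).exists_eq_range (Set.insert_nonempty _ _)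
  have hN : ∀ l, IsNowhereDense (N l) := fun l => by
    have : N l ∈ insert ∅ C := hNr ▸ Set.mem_range_self l
    rcases this with h | h
    · rw [h]; exact isNowhereDense_empty
    · exact hC _ h
  choose J hJ t ht using fun k i => exists_pattern_avoiding_all hN k i
  let i : ℕ → ℕ := Nat.rec 0 fun k ik => J k ik
  have hi : StrictMono i := strictMono_nat_of_lt_succ fun k => hJ k (i k)
  refine ⟨i, hi, fun s hs => ?_⟩
  by_contra! hcon
  let P : ℕ → ℕ → Prop := fun k n => (∀ n ∈ Set.Ico (i k) (i (k + 1)), s n ≠ true) ∧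
    n ∈ Set.Ico (i k) (i (k + 1)) ∧ t k (i k) n = true
  let s' : POmega := fun n : ℕ => @decide (s n = true ∨ ∃ k : ℕ, P k n) (Classical.propDecidable _)
  have hsub : s.toSet ⊆ s'.toSet := fun n hn => by
    have : s n = true := hn
    simp [POmega.toSet, s', this]
  have hs' : s' ∈ infSets := (hS.subset_infSets hs).mono hsub
  have hs'S : s' ∈ S := hS.mem_of_almost_subset s hs s' hs' (by
    rw [Set.sdiff_eq_empty.2 hsub]; exact Set.finite_empty)
  have hx : (⟨s', hs'⟩ : infSets) ∈ ⋃₀ C := hSC hs'S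
  obtain ⟨c, hcC, hc⟩ := hx
  obtain ⟨l, rfl⟩ : c ∈ Set.range N := hNr ▸ Set.mem_insert_of_mem _ hcC
  obtain ⟨k, hkl, hk⟩ := hcon l
  refine ht k (i k) l hkl ⟨s', hs'⟩ (fun n hn => ?_) hc
  have hn' : n ∈ Set.Ico (i k) (i (k + 1)) := hn
  -- The intervals are disjoint, so that on the `k`-th one only the `k`-th pattern was added.
  have huniq : ∀ k', P k' n → k' = k := fun k' h => by
    have h1 : k' < k + 1 := hi.lt_iff_lt.1 (h.2.1.1.trans_lt hn'.2)
    have h2 : k < k' + 1 := hi.lt_iff_lt.1 (hn'.1.trans_lt h.2.1.2)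
    omega
  have : (∃ k', P k' n) ↔ t k (i k) n = true :=
    ⟨fun ⟨k', h⟩ => by have := huniq k' h; subst this; exact h.2.2, fun h => ⟨k, hk, hn', h⟩⟩
  simp [s', this, hk n hn']

/-- The converse half: the sets meeting almost all of the intervals `[k, g k)` form a meager
semifilter. -/
theorem exists_meager_semifilter {g : ℕ → ℕ} (hg : ∀ k, k < g k) :
    ∃ S : Set POmega, IsSemifilter S ∧ IsMeagerInInfSets S ∧ ∀ s : POmega, s ∈ infSets →
      (∃ m, ∀ k ≥ m, ∃ n ∈ Set.Ico k (g k), s n = true) → s ∈ S := by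
  refine ⟨{s | s ∈ infSets ∧ ∃ m, ∀ k ≥ m, ∃ n ∈ Set.Ico k (g k), s n = true},
    ⟨⟨fun _ => true, ?_, 0, fun k _ => ⟨k, ⟨le_rfl, hg k⟩, rfl⟩⟩, fun s hs => hs.1, ?_⟩, ?_,
    fun s h1 h2 => ⟨h1, h2⟩⟩
  · exact Set.infinite_univ.mono fun n _ => rfl
  · rintro a ⟨-, m, hm⟩ b hb hab
    obtain ⟨M, hM⟩ := hab.bddAbove
    refine ⟨hb, max m (M + 1), fun k hk => ?_⟩
    obtain ⟨n, hn, han⟩ := hm k ((le_max_left _ _).trans hk)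
    refine ⟨n, hn, ?_⟩
    by_contra hbn
    have h1 : n ≤ M := hM ⟨han, hbn⟩
    have h2 := (le_max_right m (M + 1)).trans hk
    have := hn.1
    omega
  · let C : ℕ → Set infSets := fun m => ⋂ k ∈ Set.Ici m, {s | ∃ n ∈ Set.Ico k (g k), s.1 n = true}
    have hC : ∀ m, IsClosed (C m) := fun m => isClosed_biInter fun k _ => by
      have : {s : infSets | ∃ n ∈ Set.Ico k (g k), s.1 n = true} =
          Subtype.val ⁻¹' ⋃ n ∈ Set.Ico k (g k), {x : POmega | x n = true} := by
        ext s; simp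
      rw [this]
      exact ((Set.finite_Ico k (g k)).isClosed_biUnion fun n _ =>
        (isClopen_apply_eq_true n).isClosed).preimage continuous_subtype_val
    have hmeag : IsMeagre (⋃ m, C m) := isMeagre_iUnion fun m => by
      refine IsNowhereDense.isMeagre ((hC m).isNowhereDense_iff.2 ?_)
      by_contra hne
      obtain ⟨x, hx⟩ := Set.nonempty_iff_ne_empty.2 hne
      obtain ⟨O, hO, hOx⟩ := isOpen_induced_iff.1 (isOpen_interior (s := C m))
      have hxO : x.1 ∈ O := by
        have : x ∈ Subtype.val ⁻¹' O := by rw [hOx]; exact hx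
        exact this
      obtain ⟨p, hp⟩ := POmega.exists_agree_subset_of_isOpen hO hxO
      -- Change `x` so that it misses the interval `[q, g q)`, far beyond `p`.
      let q := max p m
      let y : POmega := fun n => if n < q then x.1 n else if n < g q then false else true
      have hy : y ∈ infSets := by
        refine (Set.Ici_infinite (g q)).mono fun n hn => ?_
        have h1 : g q ≤ n := hn
        have h2 := hg q
        have : y n = true := by simp only [y]; rw [if_neg (by omega), if_neg (by omega)]
        exact this
      have hyC : (⟨y, hy⟩ : infSets) ∈ C m := by
        refine interior_subset (?_ : (⟨y, hy⟩ : infSets) ∈ interior (C m))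
        rw [← hOx]
        refine hp y fun n hn => ?_
        have : n < q := hn.trans_le (le_max_left _ _)
        simp [y, this]
      obtain ⟨n, hn, hyn⟩ := Set.mem_iInter₂.1 hyC q (le_max_right p m)
      have hyn' : y n = true := hyn
      simp only [y] at hyn'
      rw [if_neg (by have := hn.1; omega), if_pos hn.2] at hyn'
      exact Bool.false_ne_true hyn'
    refine hmeag.mono fun s hs => ?_
    obtain ⟨-, m, hm⟩ := hs
    exact Set.mem_iUnion.2 ⟨m, Set.mem_iInter₂.2 fun k hk => hm k hk⟩

/-! ### The three implications -/

/-- The `σ`-compact set consists of the `x` such that `b n ≤ x n` for some `n` in almost every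
interval of a partition adapted to the semifilter, where `b` grows so fast that infinitely many
such `n` already force `x` into the given `G_δ` set. -/
theorem IsMeagerUnbounded.exists_isSigmaCompact {X : Set POmega} (hX : IsMeagerUnbounded X)
    {G : Set POmega} (hG : IsGδ G) (hfin : finSets ⊆ G) :
    ∃ F : Set POmega, IsSigmaCompact F ∧ F ⊆ G ∧ #(X \ F : Set POmega) < boundingNumber := by
  obtain ⟨hXinf, -, hX⟩ := hX
  obtain ⟨U, hU, rfl⟩ := hG.eq_iInter_nat
  -- A set missing `[k, γ j k)` lies in `U 0 ∩ ⋯ ∩ U j`.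
  have hgap : ∀ j k, ∃ g, k < g ∧ ∀ x : POmega, (∀ n ∈ Set.Ico k g, x n = false) →
      x ∈ ⋂ l ∈ Finset.range (j + 1), U l := fun j k =>
    exists_gap_subset (isOpen_biInter_finset fun l _ => hU l)
      (fun x hx => Set.mem_iInter₂.2 fun l _ => Set.mem_iInter.1 (hfin hx) l) k
  choose γ hγ hγU using hgap
  let c : ℕ → ℕ := Nat.rec 0 fun j cj => γ j cj
  have hc : StrictMono c := strictMono_nat_of_lt_succ fun j => hγ j (c j)
  -- A set with at most `n` elements below `c (2n + 1)` misses one of the `n + 1` intervals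
  -- `[c j, c (j + 1))`, `n ≤ j ≤ 2n`.
  obtain ⟨b, hb, hcb⟩ := exists_le_enum (c := fun n => c (n + (n + 1)))
    (fun m n hmn => hc (show m + (m + 1) < n + (n + 1) by omega))
  obtain ⟨S, hS, hSm, A, hAX, hA, hbx⟩ := hX b hb
  obtain ⟨i, hi, hiS⟩ := hS.exists_interval_partition hSm
  let K : ℕ → Set POmega := fun m => ⋂ k ∈ Set.Ici m, ⋃ n ∈ Set.Ico (i k) (i (k + 1)),
    {x | Nat.count (fun l => x l = true) (b.enum n) ≤ n}
  have hK : ∀ m, IsClosed (K m) := fun m => isClosed_biInter fun k _ =>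
    (Set.finite_Ico _ _).isClosed_biUnion fun n _ => (isClopen_count_le _ n).isClosed
  refine ⟨⋃ m, K m, isSigmaCompact_iUnion_of_isCompact _ fun m => (hK m).isCompact, ?_, ?_⟩
  · refine Set.iUnion_subset fun m x hx => Set.mem_iInter.2 fun l => ?_
    obtain ⟨n, hn, hxn⟩ := Set.mem_iUnion₂.1 (Set.mem_iInter₂.1 hx (max m l) (le_max_left m l))
    have hln : l ≤ n := (le_max_right m l).trans ((hi.le_apply).trans hn.1)
    have hcount : Nat.count (fun l => x l = true) (c (n + (n + 1))) ≤ n :=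
      (Nat.count_monotone _ (hcb n)).trans hxn
    by_contra hxl
    have := le_count_of_meets (x := x) (c := c) n (n + 1) fun j hj => by
      by_contra! hmiss
      have h1 := hγU j (c j) x fun r hr => by simpa using hmiss r hr
      have h2 := hj.1
      exact hxl (Set.mem_iInter₂.1 h1 l (Finset.mem_range.2 (by omega)))
    omega
  · refine (Cardinal.mk_le_mk_of_subset fun x hx => ?_).trans_lt hA
    by_contra hxA
    obtain ⟨m, hm⟩ := hiS _ (hbx x ⟨hx.1, hxA⟩)
    refine hx.2 (Set.mem_iUnion.2 ⟨m, Set.mem_iInter₂.2 fun k hk => ?_⟩)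
    obtain ⟨n, hn, hle⟩ := hm k hk
    exact Set.mem_iUnion₂.2 ⟨n, hn, (le_enum_iff (hXinf hx.1)).1 (of_decide_eq_true hle)⟩

/-- A set is Hurewicz if, inside each `G_δ` set around it, some `σ`-compact set contains all but
fewer than `𝔟` of its points. For a sequence of open covers, the `G_δ` set is the intersection of
the unions of countable subcovers, extended to the whole Cantor cube. The compact pieces and the
remaining points each give one function, and these fewer than `𝔟` functions have a common eventual
bound. -/
theorem isHurewiczSpace_of_isSigmaCompact {Y : Set POmega} (hne : Y.Nonempty)
    (hY : ∀ G : Set POmega, IsGδ G → Y ⊆ G →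
      ∃ F : Set POmega, IsSigmaCompact F ∧ F ⊆ G ∧ #(Y \ F : Set POmega) < boundingNumber) :
    IsHurewiczSpace Y := by
  intro 𝒰 h𝒰
  have hcount : ∀ n, ∃ O : ℕ → Set POmega, (∀ m, IsOpen (O m)) ∧
      (∀ m, Subtype.val ⁻¹' O m ∈ 𝒰 n) ∧ Y ⊆ ⋃ m, O m := fun n => by
    obtain ⟨T, hTc, hT, hTU⟩ := TopologicalSpace.isOpen_sUnion_countable (𝒰 n) (h𝒰 n).1
    rw [(h𝒰 n).2] at hTU
    have hTne : T.Nonempty := by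
      obtain ⟨y, hy⟩ := hne
      have h : (⟨y, hy⟩ : Y) ∈ ⋃₀ T := hTU ▸ Set.mem_univ _
      obtain ⟨t, ht, -⟩ := h
      exact ⟨t, ht⟩
    obtain ⟨u, rfl⟩ := hTc.exists_eq_range hTne
    choose O hO hOu using fun m => isOpen_induced_iff.1 ((h𝒰 n).1 (u m) (hT ⟨m, rfl⟩))
    refine ⟨O, hO, fun m => (hOu m).symm ▸ hT ⟨m, rfl⟩, fun y hy => ?_⟩
    have h : (⟨y, hy⟩ : Y) ∈ ⋃₀ Set.range u := hTU ▸ Set.mem_univ _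
    obtain ⟨_, ⟨m, rfl⟩, hm⟩ := h
    rw [← hOu m] at hm
    exact Set.mem_iUnion.2 ⟨m, hm⟩
  choose O hO hO𝒰 hYO using hcount
  obtain ⟨F, ⟨K, hK, rfl⟩, hFG, hF⟩ := hY (⋂ n, ⋃ m, O n m)
    (IsGδ.iInter fun n => (isOpen_iUnion (hO n)).isGδ) (Set.subset_iInter hYO)
  have hKM : ∀ j n, ∃ M, K j ⊆ ⋃ m ∈ Set.Iic M, O n m := fun j n => by
    refine (hK j).elim_directed_cover (fun M => ⋃ m ∈ Set.Iic M, O n m)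
      (fun M => isOpen_biUnion fun m _ => hO n m) (fun x hx => ?_) ?_
    · obtain ⟨m, hm⟩ := Set.mem_iUnion.1
        (Set.mem_iInter.1 (hFG (Set.mem_iUnion_of_mem j hx)) n)
      exact Set.mem_iUnion.2 ⟨m, Set.mem_iUnion₂.2 ⟨m, Set.mem_Iic.2 le_rfl, hm⟩⟩
    · exact Monotone.directed_le fun a b hab =>
        Set.biUnion_subset_biUnion_left (Set.Iic_subset_Iic.2 hab)
  choose M hM using hKM
  choose f hf using fun (y : Y) n => Set.mem_iUnion.1 (hYO n y.2)
  obtain ⟨g, hg⟩ : IsStarBounded (Set.range M ∪ f '' (Subtype.val ⁻¹' (Y \ ⋃ j, K j))) := by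
    refine isStarBounded_of_mk_lt (mk_union_lt_boundingNumber ?_ ?_)
    · exact (Cardinal.le_aleph0_iff_set_countable.2 (Set.countable_range M)).trans_lt
        aleph0_lt_boundingNumber
    · exact (Cardinal.mk_image_le.trans
        (Cardinal.mk_preimage_of_injective _ _ Subtype.val_injective)).trans_lt hF
  refine ⟨fun n => (fun m => Subtype.val ⁻¹' O n m) '' Set.Iic (g n), fun n =>
    ⟨Set.image_subset_iff.2 fun m _ => hO𝒰 n m, (Set.finite_Iic _).image _⟩, fun y => ?_⟩
  by_cases hy : y.1 ∈ ⋃ j, K j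
  · obtain ⟨j, hj⟩ := Set.mem_iUnion.1 hy
    refine (hg (M j) (Or.inl ⟨j, rfl⟩)).subset fun n hn hle => hn ?_
    obtain ⟨m, hm, hym⟩ := Set.mem_iUnion₂.1 (hM j n hj)
    exact ⟨_, ⟨m, le_trans hm hle, rfl⟩, hym⟩
  · refine (hg (f y) (Or.inr ⟨y, ⟨y.2, hy⟩, rfl⟩)).subset fun n hn hle => hn ?_
    exact ⟨_, ⟨f y n, hle, rfl⟩, hf y n⟩

/-- A Hurewicz set of points `x` that satisfy `b n ≤ x n` infinitely often does so modulo a single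
meager semifilter: `x` satisfies the inequality for some `n` in `[k, g k)`, for almost all `k`, with
one function `g` for all `x`. -/
theorem exists_leMod_of_isHurewiczSpace {b : POmega} {Y : Set POmega} (hY : IsHurewiczSpace Y)
    (hYb : ∀ x ∈ Y, ∀ k, ∃ n ≥ k, Nat.count (fun l => x l = true) (b.enum n) ≤ n) :
    ∃ S : Set POmega, IsSemifilter S ∧ IsMeagerInInfSets S ∧
      ∀ x ∈ Y, x ∈ infSets → LeMod S b x := by
  let V : ℕ → ℕ → Set Y := fun k m => {x | ∃ n ∈ Set.Ico k m,
    Nat.count (fun l => x.1 l = true) (b.enum n) ≤ n}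
  have hV : ∀ k m, IsOpen (V k m) := fun k m => by
    have : V k m = Subtype.val ⁻¹' ⋃ n ∈ Set.Ico k m,
        {x : POmega | Nat.count (fun l => x l = true) (b.enum n) ≤ n} := by
      ext x; simp [V]
    rw [this]
    exact (isOpen_biUnion fun n _ => (isClopen_count_le _ n).isOpen).preimage
      continuous_subtype_val
  have hVmono : ∀ k, Monotone (V k) := fun k a c hac x ⟨n, hn, hx⟩ =>
    ⟨n, ⟨hn.1, hn.2.trans_le hac⟩, hx⟩
  obtain ⟨ℱ, hℱ, hcov⟩ := hY (fun k => Set.range (V k)) fun k =>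
    ⟨by rintro _ ⟨m, rfl⟩; exact hV k m, Set.eq_univ_of_forall fun x => by
      obtain ⟨n, hkn, hn⟩ := hYb x.1 x.2 k
      exact ⟨_, ⟨n + 1, rfl⟩, n, ⟨hkn, n.lt_succ_self⟩, hn⟩⟩
  have hg : ∀ k, ∃ g, k < g ∧ ⋃₀ ℱ k ⊆ V k g := fun k => by
    choose! μ hμ using (hℱ k).1
    obtain ⟨m, hm⟩ := ((hℱ k).2.image μ).bddAbove
    refine ⟨max m (k + 1), by simp, Set.sUnion_subset fun u hu => ?_⟩
    rw [← hμ hu]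
    exact hVmono k ((hm ⟨u, hu, rfl⟩).trans (le_max_left _ _))
  choose g hkg hg using hg
  obtain ⟨S, hS, hSm, hmem⟩ := exists_meager_semifilter hkg
  refine ⟨S, hS, hSm, fun x hxY hx => ?_⟩
  have hle : ∀ n, Nat.count (fun l => x l = true) (b.enum n) ≤ n ↔ b.enum n ≤ x.enum n :=
    fun n => (le_enum_iff hx).symm
  refine hmem _ ?_ ?_
  · refine Set.infinite_of_forall_exists_gt fun k => ?_
    obtain ⟨n, hkn, hn⟩ := hYb x hxY (k + 1)
    exact ⟨n, decide_eq_true ((hle n).1 hn), hkn⟩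
  · obtain ⟨m, hm⟩ := (hcov ⟨x, hxY⟩).bddAbove
    refine ⟨m + 1, fun k hk => ?_⟩
    have hxk : (⟨x, hxY⟩ : Y) ∈ ⋃₀ ℱ k := by
      by_contra hcon
      exact absurd (hm hcon) (by omega)
    obtain ⟨n, hn, hxn⟩ := hg k hxk
    exact ⟨n, hn, decide_eq_true ((hle n).1 hxn)⟩

/-- The exceptional set `A` consists of the points of `X` with `b n ≤ x n` for only finitely many
`n`; it is a countable union of sets made small by concentration, hence small since `𝔟` has
uncountable cofinality. -/
theorem isMeagerUnbounded_of_isConcentratedOn {X : Set POmega} (hX : X ⊆ infSets)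
    (hconc : IsConcentratedOn boundingNumber (X ∪ finSets) finSets)
    (hH : ∀ A ⊆ X, #A < boundingNumber → IsHurewiczSpace ((X \ A) ∪ finSets : Set POmega)) :
    IsMeagerUnbounded X := by
  obtain ⟨-, hcard, hU⟩ := hconc
  refine ⟨hX, ?_, fun b hb => ?_⟩
  · by_contra! hlt
    exact absurd (mk_union_lt_boundingNumber hlt
      ((Cardinal.le_aleph0_iff_set_countable.2 countable_finSets).trans_lt
        aleph0_lt_boundingNumber)) hcard.not_gt
  let W : ℕ → Set POmega := fun k => ⋃ n ∈ Set.Ici k,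
    {x | Nat.count (fun l => x l = true) (b.enum n) ≤ n}
  have hW : ∀ k, IsOpen (W k) := fun k => isOpen_biUnion fun n _ => (isClopen_count_le _ n).isOpen
  have hfin : ∀ k, finSets ⊆ W k := fun k x hx => by
    have hle : ∀ m, Nat.count (fun l => x l = true) m ≤ x.toSet.ncard := fun m => by
      rw [Nat.count_eq_card_filter_range, ← Set.ncard_coe_finset]
      exact Set.ncard_le_ncard (fun n hn => (Finset.mem_filter.1 hn).2) hx
    exact Set.mem_iUnion₂.2 ⟨max k x.toSet.ncard, Set.mem_Ici.2 (le_max_left _ _),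
      (hle _).trans (le_max_right _ _)⟩
  let A : Set POmega := ⋃ k, (X ∪ finSets) \ W k
  have hA : #A < boundingNumber := mk_iUnion_lt_boundingNumber fun k => hU _ (hW k) (hfin k)
  have hAX : A ⊆ X := Set.iUnion_subset fun k x hx => hx.1.resolve_right fun h => hx.2 (hfin k h)
  obtain ⟨S, hS, hSm, hle⟩ := exists_leMod_of_isHurewiczSpace (b := b) (hH A hAX hA) fun x hx k => by
    have hxW : x ∈ W k := by
      rcases hx with hx | hx
      · by_contra hcon
        exact hx.2 (Set.mem_iUnion.2 ⟨k, Or.inl hx.1, hcon⟩)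
      · exact hfin k hx
    obtain ⟨n, hn, hxn⟩ := Set.mem_iUnion₂.1 hxW
    exact ⟨n, hn, hxn⟩
  exact ⟨S, hS, hSm, A, hAX, hA, fun x hx => hle x (Or.inl hx) (hX hx.1)⟩

theorem mainTheorem1 (X : Set POmega) (hX : X ⊆ infSets) :
    List.TFAE [
      IsMeagerUnbounded X,
      boundingNumber ≤ #X ∧
        ∀ G : Set POmega, IsGδ G → finSets ⊆ G →
          ∃ F : Set POmega, IsSigmaCompact F ∧ F ⊆ G ∧ #(X \ F : Set POmega) < boundingNumber,
      IsConcentratedOn boundingNumber (X ∪ finSets) finSets ∧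
        ∀ A ⊆ X, #A < boundingNumber →
          IsHurewiczSpace ((X \ A) ∪ finSets : Set POmega)] := by
  tfae_have 1 → 2 := fun h => ⟨h.2.1, fun G hG hfin => h.exists_isSigmaCompact hG hfin⟩
  tfae_have 2 → 3 := by
    rintro ⟨hcard, h⟩
    refine ⟨⟨Set.subset_union_right, hcard.trans (Cardinal.mk_le_mk_of_subset
      Set.subset_union_left), fun U hU hfin => ?_⟩, fun A _ _ =>
      isHurewiczSpace_of_isSigmaCompact ?_ fun G hG hYG => ?_⟩
    · obtain ⟨F, -, hFU, hF⟩ := h U hU.isGδ hfin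
      refine (Cardinal.mk_le_mk_of_subset fun x hx => ?_).trans_lt hF
      exact ⟨hx.1.resolve_right fun hx' => hx.2 (hfin hx'), fun hxF => hx.2 (hFU hxF)⟩
    · exact ⟨fun _ => false, Or.inr (by simp [finSets, POmega.toSet])⟩
    · obtain ⟨F, hF, hFG, hXF⟩ := h G hG (Set.subset_union_right.trans hYG)
      refine ⟨F, hF, hFG, (Cardinal.mk_le_mk_of_subset (t := (X \ F) ∪ finSets) ?_).trans_lt
        (mk_union_lt_boundingNumber hXF ((Cardinal.le_aleph0_iff_set_countable.2
          countable_finSets).trans_lt aleph0_lt_boundingNumber))⟩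
      rintro x ⟨hx | hx, hxF⟩
      · exact Or.inl ⟨hx.1, hxF⟩
      · exact Or.inr hx
  tfae_have 3 → 1 := fun h => isMeagerUnbounded_of_isConcentratedOn hX h.1 h.2
  tfae_finish
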